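/- Let $\mathbb{T}^2=\mathbb{R}^2/\mathbb{Z}^2$ be the flat torus with geodesic distance $d$. For $p>0$ and pairwise distinct points $x_1,\dots,x_n\in\mathbb{T}^2$ let $$E_p(x_1,\dots,x_n)=\sum_{\substack{i,j=1\\ i\neq j}}^{n}\frac{1}{d(x_i,x_j)^p}.$$ The function $d$ is not differentiable at its cut locus (pairs of points having a coordinate that differs by exactly $1/2$), so critical points are understood as follows: a configuration $x=(x_1,\dots,x_n)$ of pairwise distinct points is a critical point of $E_p$ if $0$ belongs to the Fréchet subdifferential of $E_p$ at $x$, that is, $E_p(x+h)\ge E_p(x)-o(\|h\|)$ as $h\to 0$ in $(\mathbb{R}^2)^n$. Where $E_p$ is differentiable this means exactly $\nabla E_p(x)=0$; everywhere else $E_p$ is locally a maximum of finitely many smooth functions, and this is the same as $0$ belonging to the Clarke subdifferential. Two configurations $x,y$ are identified if there are a permutation $\sigma$ of $\{1,\dots,n\}$ and an isometry $\varphi$ of $\mathbb{T}^2$ with $y_i=\varphi(x_{\sigma(i)})$ for all $i$. **Theorem 1.** There exist constants $c_1,c_2>0$ such that, for the infinite set $A=\{60\ell^2:\ell\in\mathbb{N},\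 \ell\ge 1\}$, the following holds: for every $n\in A$ and every real $p>5\log n$, the energy $E_p$ on $(\mathbb{T}^2)^n$ has, up to this identification, at least $c_1\exp(c_2\sqrt{n})$ critical points (possibly infinitely many). -/

import Mathlib

open scoped Topology ENNReal

noncomputable section

/-- The flat torus `𝕋² = ℝ²/ℤ²`. The metric on `UnitAddCircle = ℝ/ℤ` is the arc length metric of a
circle of length one, so the `ℓ²` product metric is the geodesic distance of the flat torus. -/
abbrev FlatTorus : Type := PiLp 2 (fun _ : Fin 2 => UnitAddCircle)

namespace FlatTorus

/-- The covering map `ℝ² → ℝ²/ℤ²`. For a point `x` of the torus, `v ↦ x + proj v` is the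
Riemannian exponential map at `x`. -/
def proj (v : EuclideanSpace ℝ (Fin 2)) : FlatTorus :=
  WithLp.toLp 2 (fun k => (v k : UnitAddCircle))

/-- The Riesz `p`-energy `∑_{i ≠ j} 1 / d(x_i, x_j)^p` of a configuration of `n` points
(it is only meaningful for pairwise distinct points). -/
def rieszEnergy {n : ℕ} (p : ℝ) (x : Fin n → FlatTorus) : ℝ :=
  ∑ i : Fin n, ∑ j ∈ Finset.univ.filter (fun j => j ≠ i), 1 / dist (x i) (x j) ^ p

/-- `x` is a critical point of the Riesz `p`-energy: its points are pairwise distinct (otherwise the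
energy is infinite) and `0` lies in the Fréchet subdifferential of the energy at `x`, that is,
`E(exp_x h) ≥ E(x) - o(‖h‖)` as `h → 0`.

Where the energy is differentiable, this says exactly that its gradient vanishes (see
`isCriticalPoint_iff_of_hasFDerivAt`). The geodesic distance is not differentiable at the cut locus
(pairs of points with a coordinate differing by exactly `1/2`). There the energy is locally a maximum
of finitely many smooth functions, for which the Fréchet and the Clarke subdifferential agree. -/
def IsCriticalPoint {n : ℕ} (p : ℝ) (x : Fin n → FlatTorus) : Prop :=
  Function.Injective x ∧
    ∀ ε : ℝ, 0 < ε → ∀ᶠ h in 𝓝 (0 : Fin n → EuclideanSpace ℝ (Fin 2)),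
      rieszEnergy p x - ε * ‖h‖ ≤ rieszEnergy p (fun i => x i + proj (h i))

theorem proj_zero : proj 0 = 0 := by
  ext k
  simp [proj]

/-- Where the energy is differentiable, critical points are the zeros of its derivative. -/
theorem isCriticalPoint_iff_of_hasFDerivAt {n : ℕ} {p : ℝ} {x : Fin n → FlatTorus}
    (hx : Function.Injective x) {L : (Fin n → EuclideanSpace ℝ (Fin 2)) →L[ℝ] ℝ}
    (hL : HasFDerivAt (fun h : Fin n → EuclideanSpace ℝ (Fin 2) =>
      rieszEnergy p (fun i => x i + proj (h i))) L 0) :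
    IsCriticalPoint p x ↔ L = 0 := by
  have h0 : rieszEnergy p (fun i => x i + proj ((0 : Fin n → EuclideanSpace ℝ (Fin 2)) i))
      = rieszEnergy p x := by simp [proj_zero]
  have hlo := (hasFDerivAt_iff_isLittleO_nhds_zero.1 hL)
  simp only [zero_add, h0] at hlo
  constructor
  · rintro ⟨-, hc⟩
    have key : ∀ v, 0 ≤ L v := by
      intro v
      by_contra! hv
      have hv0 : v ≠ 0 := by rintro rfl; simp at hv
      have hn : 0 < ‖v‖ := norm_pos_iff.2 hv0
      have hε : 0 < -L v / (4 * ‖v‖) := by have := neg_pos.2 hv; positivity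
      have e := (hc _ hε).and (hlo.bound hε)
      have ht : Filter.Tendsto (fun t : ℝ => t • v) (𝓝[>] 0) (𝓝 0) := by
        have : Filter.Tendsto (fun t : ℝ => t • v) (𝓝 0) (𝓝 ((0 : ℝ) • v)) :=
          (continuous_id.smul continuous_const).tendsto 0
        rw [zero_smul] at this
        exact this.mono_left nhdsWithin_le_nhds
      obtain ⟨t, ⟨h1, h2⟩, ht0⟩ := ((ht.eventually e).and self_mem_nhdsWithin).exists
      have ht0 : 0 < t := ht0
      have hnn : -L v / (4 * ‖v‖) * ‖t • v‖ = t * (-L v) / 4 := by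
        rw [norm_smul, Real.norm_of_nonneg ht0.le]; field_simp
      rw [hnn] at h1 h2
      rw [map_smul, smul_eq_mul, Real.norm_eq_abs] at h2
      have := (abs_le.1 h2).2
      nlinarith [mul_pos ht0 (neg_pos.2 hv)]
    ext v
    have h1 := key v
    have h2 := key (-v)
    rw [map_neg] at h2
    simp only [_root_.zero_apply]
    linarith
  · rintro rfl
    refine ⟨hx, fun ε hε => ?_⟩
    filter_upwards [hlo.bound hε] with h hh
    simp only [_root_.zero_apply, sub_zero, Real.norm_eq_abs] at hh
    linarith [(abs_le.1 hh).1]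

/-- Two configurations are geometrically the same if they differ by a relabeling of the points and an
isometry of the torus. -/
def symmetrySetoid (n : ℕ) : Setoid (Fin n → FlatTorus) where
  r x y := ∃ (σ : Equiv.Perm (Fin n)) (φ : FlatTorus ≃ᵢ FlatTorus), ∀ i, y i = φ (x (σ i))
  iseqv :=
    { refl := fun x => ⟨1, IsometryEquiv.refl _, fun _ => rfl⟩
      symm := by
        rintro x y ⟨σ, φ, h⟩
        exact ⟨σ.symm, φ.symm, fun i => by simp [h]⟩
      trans := by
        rintro x y z ⟨σ, φ, h⟩ ⟨τ, ψ, k⟩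
        exact ⟨τ.trans σ, φ.trans ψ, fun i => by simp [h, k]⟩ }

/-- The set of critical points of the Riesz `p`-energy of `n` points, with relabelings and
isometries factored out. -/
def criticalClasses (n : ℕ) (p : ℝ) : Set (Quotient (symmetrySetoid n)) :=
  Quotient.mk (symmetrySetoid n) '' {x | IsCriticalPoint p x}

end FlatTorus

end

/-!
The critical points are configurations of `m = 6ℓ` horizontal rows of `k = 10ℓ` equidistant points,
where each row is shifted horizontally by `0` or by half a step. The shifts are arbitrary, and for each
choice of shifts the heights of the rows are found by minimization.

*Criticality.* A row configuration is invariant under translations by `1 / k` along the rows and, since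
all shifts are `0` or half a step, under reflections in a vertical axis. Averaging a displacement over
this finite group gives a displacement that only moves whole rows up or down
(`average_rowSymmetry`). The energy is semiconvex near every configuration of distinct points, even at
the cut locus, because the squared distance is a minimum of squared Euclidean distances
(`semiconvexNearZero_interaction`). Hence averaging increases it by at most a quadratic error, and
a local minimum with respect to the heights of the rows is a critical point with respect to all
displacements (`SemiconvexNearZero.le_of_average`, `rowConfig_quadratic_lower_bound`).

*Existence of heights.* The energy is minimized over the compact cell of increasingly ordered heights
with all gaps at least `1 / (4k)`. For equidistant heights all distances are at least `1 / k`, so the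
energy is at most `n² kᵖ`. On the boundary of the cell two points have squared distance at most
`5 / (16 k²)`, so the energy is at least `(16 / 5) ^ (p / 2) kᵖ`, which is larger since
`n² < exp (p / 2)`. So the minimum lies in the interior (`exists_heights`).

*Counting.* An isometry of the torus is determined by the image of the origin and of four further points,
whose images relative to that of the origin lie in a set of six points (`isometryEquiv_ext`,
`isometryEquiv_frame_sub_mem`). Since all the configurations contain the origin and a configuration
determines its shifts, a class contains at most `6⁴ n` of the `2 ^ (m - 1)` configurations with an unshifted
first row (`card_le_mul_card_image_quotient`).
-/

namespace FlatTorus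

/-! ### Norms and lifts on the circle and the torus -/

theorem norm_coe_circle_le (x : ℝ) : ‖(x : UnitAddCircle)‖ ≤ |x| := by
  rw [UnitAddCircle.norm_eq]
  simpa using round_le x 0

theorem norm_coe_circle_of_abs_le {x : ℝ} (hx : |x| ≤ 1 / 2) : ‖(x : UnitAddCircle)‖ = |x| := by
  rw [AddCircle.norm_coe_eq_abs_iff 1 one_ne_zero]
  simpa using hx

theorem exists_circle_lift (a : UnitAddCircle) :
    ∃ t : ℝ, (t : UnitAddCircle) = a ∧ |t| = ‖a‖ ∧ |t| ≤ 1 / 2 := by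
  obtain ⟨x, rfl⟩ := QuotientAddGroup.mk_surjective a
  refine ⟨x - round x, ?_, UnitAddCircle.norm_eq.symm, abs_sub_round x⟩
  rw [AddCircle.coe_sub]
  have : ((round x : ℝ) : UnitAddCircle) = 0 := by
    rw [AddCircle.coe_eq_zero_iff]
    exact ⟨round x, by simp⟩
  rw [this, sub_zero]

theorem le_norm_coe_circle {a t : ℝ} (h₁ : a ≤ t) (h₂ : t ≤ 1 - a) :
    a ≤ ‖(t : UnitAddCircle)‖ := by
  rw [UnitAddCircle.norm_eq]
  rcases le_or_gt (round t) 0 with h | h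
  · have : ((round t : ℤ) : ℝ) ≤ 0 := by exact_mod_cast h
    exact le_trans (by linarith) (le_abs_self _)
  · have : (1 : ℝ) ≤ ((round t : ℤ) : ℝ) := by exact_mod_cast h
    exact le_trans (by linarith) (neg_le_abs _)

theorem norm_sq_eq (u : FlatTorus) : ‖u‖ ^ 2 = ‖u 0‖ ^ 2 + ‖u 1‖ ^ 2 := by
  rw [PiLp.norm_sq_eq_of_L2, Fin.sum_univ_two]

theorem proj_add (v w : EuclideanSpace ℝ (Fin 2)) : proj (v + w) = proj v + proj w := by
  ext k
  simp [proj]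

theorem proj_sub (v w : EuclideanSpace ℝ (Fin 2)) : proj (v - w) = proj v - proj w := by
  ext k
  simp [proj]

theorem norm_proj_le (v : EuclideanSpace ℝ (Fin 2)) : ‖proj v‖ ≤ ‖v‖ := by
  refine le_of_sq_le_sq ?_ (norm_nonneg v)
  rw [norm_sq_eq, EuclideanSpace.norm_sq_eq, Fin.sum_univ_two]
  gcongr <;> exact norm_coe_circle_le _

/-- Every point of the torus has a lift at minimal distance from the origin. -/
theorem exists_lift_norm_eq (u : FlatTorus) :
    ∃ z : EuclideanSpace ℝ (Fin 2), proj z = u ∧ ‖z‖ = ‖u‖ := by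
  obtain ⟨a, ha, ha', -⟩ := exists_circle_lift (u 0)
  obtain ⟨b, hb, hb', -⟩ := exists_circle_lift (u 1)
  refine ⟨!₂[a, b], ?_, ?_⟩
  · ext k
    fin_cases k <;> simp [proj, ha, hb]
  · refine (sq_eq_sq₀ (norm_nonneg _) (norm_nonneg _)).1 ?_
    rw [norm_sq_eq, EuclideanSpace.norm_sq_eq, Fin.sum_univ_two]
    simp [← ha', ← hb']

/-! ### Semiconvexity of the energy -/

/-- `f` is semiconvex near the origin: at each point near `0` it is supported from below by an affine
function, up to a quadratic error with a uniform constant. -/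
def SemiconvexNearZero {V : Type*} [NormedAddCommGroup V] [NormedSpace ℝ V] (f : V → ℝ) : Prop :=
  ∃ C δ : ℝ, 0 ≤ C ∧ 0 < δ ∧ ∀ v₀ : V, ‖v₀‖ < δ → ∃ L : V →ₗ[ℝ] ℝ, ∀ v : V, ‖v‖ < δ →
    f v₀ + L (v - v₀) - C * ‖v - v₀‖ ^ 2 ≤ f v

section Semiconvex

variable {V W : Type*} [NormedAddCommGroup V] [NormedSpace ℝ V] [NormedAddCommGroup W]
  [NormedSpace ℝ W]

theorem SemiconvexNearZero.const (c : ℝ) : SemiconvexNearZero (fun _ : V => c) :=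
  ⟨0, 1, le_rfl, one_pos, fun _ _ => ⟨0, fun _ _ => by simp⟩⟩

theorem SemiconvexNearZero.add {f g : V → ℝ} (hf : SemiconvexNearZero f)
    (hg : SemiconvexNearZero g) : SemiconvexNearZero (fun v => f v + g v) := by
  obtain ⟨C, δ, hC, hδ, h⟩ := hf
  obtain ⟨C', δ', hC', hδ', h'⟩ := hg
  refine ⟨C + C', min δ δ', by positivity, lt_min hδ hδ', fun v₀ hv₀ => ?_⟩
  obtain ⟨L, hL⟩ := h v₀ (hv₀.trans_le (min_le_left _ _))
  obtain ⟨L', hL'⟩ := h' v₀ (hv₀.trans_le (min_le_right _ _))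
  refine ⟨L + L', fun v hv => ?_⟩
  have h1 := hL v (hv.trans_le (min_le_left _ _))
  have h2 := hL' v (hv.trans_le (min_le_right _ _))
  rw [LinearMap.add_apply]
  linarith

theorem SemiconvexNearZero.sum {ι : Type*} (s : Finset ι) {f : ι → V → ℝ}
    (hf : ∀ i ∈ s, SemiconvexNearZero (f i)) : SemiconvexNearZero (fun v => ∑ i ∈ s, f i v) := by
  classical
  induction s using Finset.induction_on with
  | empty => simpa using SemiconvexNearZero.const 0
  | insert a s ha ih =>
    simp only [Finset.sum_insert ha]
    exact (hf a (Finset.mem_insert_self a s)).add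
      (ih fun i hi => hf i (Finset.mem_insert_of_mem hi))

theorem SemiconvexNearZero.comp_linear {f : W → ℝ} (hf : SemiconvexNearZero f) (T : V →ₗ[ℝ] W)
    {M : ℝ} (hM : 0 < M) (hT : ∀ v, ‖T v‖ ≤ M * ‖v‖) : SemiconvexNearZero (fun v => f (T v)) := by
  obtain ⟨C, δ, hC, hδ, h⟩ := hf
  have hsmall : ∀ v, ‖v‖ < δ / M → ‖T v‖ < δ := fun v hv =>
    (hT v).trans_lt (by rwa [lt_div_iff₀' hM] at hv)
  refine ⟨C * M ^ 2, δ / M, by positivity, by positivity, fun v₀ hv₀ => ?_⟩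
  obtain ⟨L, hL⟩ := h (T v₀) (hsmall v₀ hv₀)
  refine ⟨L ∘ₗ T, fun v hv => ?_⟩
  have h1 := hL (T v) (hsmall v hv)
  have h2 : ‖T v - T v₀‖ ^ 2 ≤ M ^ 2 * ‖v - v₀‖ ^ 2 := by
    rw [← map_sub, ← mul_pow]
    gcongr
    exact hT _
  have h3 := mul_le_mul_of_nonneg_left h2 hC
  rw [LinearMap.comp_apply, map_sub T]
  linarith

end Semiconvex

/-- The tangent line of the convex function `t ↦ t ^ (-q)` lies below its graph. -/
theorem rpow_neg_tangent_le {q t₀ t : ℝ} (hq : 0 ≤ q) (ht₀ : 0 < t₀) (ht : 0 < t) :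
    t₀ ^ (-q) - q * (t₀ ^ (-q) / t₀) * (t - t₀) ≤ t ^ (-q) := by
  have h1 : t ^ (-q) = t₀ ^ (-q) * (t / t₀) ^ (-q) := by
    rw [← Real.mul_rpow ht₀.le (by positivity), mul_div_cancel₀ _ ht₀.ne']
  have h2 : 1 - q * (t / t₀ - 1) ≤ (t / t₀) ^ (-q) := by
    rw [Real.rpow_def_of_pos (by positivity)]
    have h3 := Real.add_one_le_exp (Real.log (t / t₀) * -q)
    have h4 := mul_le_mul_of_nonneg_left (Real.log_le_sub_one_of_pos (show 0 < t / t₀ by positivity)) hq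
    linarith
  have h5 : t₀ ^ (-q) - q * (t₀ ^ (-q) / t₀) * (t - t₀)
      = t₀ ^ (-q) * (1 - q * (t / t₀ - 1)) := by
    field_simp
  rw [h1, h5]
  gcongr

theorem one_div_norm_rpow (u : FlatTorus) (p : ℝ) :
    1 / ‖u‖ ^ p = (‖u‖ ^ 2) ^ (-(p / 2)) := by
  rw [← Real.rpow_natCast, ← Real.rpow_mul (norm_nonneg u), one_div, ← Real.rpow_neg (norm_nonneg u)]
  congr 1
  push_cast
  ring

/-- The interaction of two distinct points is semiconvex in their relative displacement: the squared
distance to a fixed point is bounded above by the squared Euclidean distance along any lift, with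
equality for a minimal lift, and `t ↦ t ^ (-p / 2)` is decreasing and convex. This needs no
differentiability of the distance, so the cut locus is no exception. -/
theorem semiconvexNearZero_interaction {p : ℝ} (hp : 0 < p) {u : FlatTorus} (hu : u ≠ 0) :
    SemiconvexNearZero (fun v => 1 / ‖u + proj v‖ ^ p) := by
  have hn : 0 < ‖u‖ := norm_pos_iff.2 hu
  have hlow : ∀ v : EuclideanSpace ℝ (Fin 2), ‖v‖ < ‖u‖ / 2 → ‖u‖ / 2 < ‖u + proj v‖ := by
    intro v hv
    have h1 : ‖u‖ ≤ ‖u + proj v‖ + ‖proj v‖ := by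
      simpa using norm_sub_le (u + proj v) (proj v)
    linarith [norm_proj_le v]
  set r : ℝ := (‖u‖ / 2) ^ 2 with hr
  have hr0 : 0 < r := by positivity
  refine ⟨p / 2 * (r ^ (-(p / 2)) / r), ‖u‖ / 2, by positivity, by positivity, fun v₀ hv₀ => ?_⟩
  obtain ⟨z, hz, hzn⟩ := exists_lift_norm_eq (u + proj v₀)
  set t₀ : ℝ := ‖u + proj v₀‖ ^ 2 with ht₀
  have hrt : r ≤ t₀ := by
    have := hlow v₀ hv₀
    rw [hr, ht₀]
    gcongr
  have ht₀0 : 0 < t₀ := hr0.trans_le hrt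
  set D : ℝ := p / 2 * (t₀ ^ (-(p / 2)) / t₀) with hD
  have hD0 : 0 ≤ D := by positivity
  have hDC : D ≤ p / 2 * (r ^ (-(p / 2)) / r) := by
    have h1 : t₀ ^ (-(p / 2)) ≤ r ^ (-(p / 2)) :=
      Real.rpow_le_rpow_of_nonpos hr0 hrt (by linarith)
    rw [hD]
    gcongr
  refine ⟨(-(2 * D)) • (innerₗ (EuclideanSpace ℝ (Fin 2)) z), fun v hv => ?_⟩
  have hpos : 0 < ‖u + proj v‖ ^ 2 := by
    have := hlow v hv
    have : 0 < ‖u + proj v‖ := by linarith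
    positivity
  have hdist : ‖u + proj v‖ ^ 2 ≤ t₀ + 2 * inner ℝ z (v - v₀) + ‖v - v₀‖ ^ 2 := by
    have h1 : u + proj v = proj (z + (v - v₀)) := by
      rw [proj_add, hz, proj_sub]
      abel
    calc ‖u + proj v‖ ^ 2 ≤ ‖z + (v - v₀)‖ ^ 2 := by
          rw [h1]
          gcongr
          exact norm_proj_le _
      _ = _ := by rw [norm_add_sq_real, hzn]
  have htan := rpow_neg_tangent_le (q := p / 2) (by positivity) ht₀0 hpos
  rw [← hD] at htan
  simp only [one_div_norm_rpow, ← ht₀]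
  have h1 := mul_le_mul_of_nonneg_left hdist hD0
  have h2 := mul_le_mul_of_nonneg_right hDC (sq_nonneg ‖v - v₀‖)
  have h3 : ((-(2 * D)) • (innerₗ (EuclideanSpace ℝ (Fin 2)) z)) (v - v₀)
      = -(2 * D) * inner ℝ z (v - v₀) := by simp
  rw [h3]
  nlinarith

/-- The Riesz energy of a configuration indexed by an arbitrary finite type. -/
noncomputable def energy {ι : Type*} [Fintype ι] [DecidableEq ι] (p : ℝ) (x : ι → FlatTorus) : ℝ :=
  ∑ i : ι, ∑ j ∈ Finset.univ.filter (fun j => j ≠ i), 1 / dist (x i) (x j) ^ p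

section Energy

variable {ι κ : Type*} [Fintype ι] [DecidableEq ι] [Fintype κ] [DecidableEq κ]

theorem energy_comp_equiv (p : ℝ) (x : ι → FlatTorus) (e : κ ≃ ι) :
    energy p (x ∘ e) = energy p x := by
  simp only [energy, Finset.sum_filter]
  refine Fintype.sum_equiv e _ _ fun i => Fintype.sum_equiv e _ _ fun j => ?_
  simp

theorem energy_congr_dist (p : ℝ) {x y : ι → FlatTorus}
    (h : ∀ i j, dist (x i) (x j) = dist (y i) (y j)) : energy p x = energy p y := by
  simp only [energy, h]

theorem one_div_dist_rpow_le_energy (p : ℝ) (x : ι → FlatTorus) {i j : ι} (hij : j ≠ i) :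
    1 / dist (x i) (x j) ^ p ≤ energy p x := by
  have hnn : ∀ i j : ι, 0 ≤ 1 / dist (x i) (x j) ^ p := fun i j => by positivity
  calc 1 / dist (x i) (x j) ^ p
      ≤ ∑ j ∈ Finset.univ.filter (fun j => j ≠ i), 1 / dist (x i) (x j) ^ p :=
        Finset.single_le_sum (f := fun j => 1 / dist (x i) (x j) ^ p) (fun j _ => hnn i j)
          (by simpa using hij)
    _ ≤ energy p x :=
        Finset.single_le_sum
          (f := fun i => ∑ j ∈ Finset.univ.filter (fun j => j ≠ i), 1 / dist (x i) (x j) ^ p)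
          (fun i _ => Finset.sum_nonneg fun j _ => hnn i j) (Finset.mem_univ i)

theorem energy_le_of_forall_le {p : ℝ} {x : ι → FlatTorus} {B : ℝ} (hB : 0 ≤ B)
    (h : ∀ i j, j ≠ i → 1 / dist (x i) (x j) ^ p ≤ B) :
    energy p x ≤ (Fintype.card ι : ℝ) ^ 2 * B := by
  have h1 : ∀ i : ι, ∑ j ∈ Finset.univ.filter (fun j => j ≠ i), 1 / dist (x i) (x j) ^ p
      ≤ Fintype.card ι * B := by
    intro i
    calc _ ≤ ∑ j ∈ Finset.univ.filter (fun j => j ≠ i), B :=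
          Finset.sum_le_sum fun j hj => h i j (by simpa using hj)
      _ = ((Finset.univ.filter (fun j => j ≠ i)).card : ℝ) * B := by simp
      _ ≤ Fintype.card ι * B := by
          gcongr
          exact Finset.card_le_univ _
  calc energy p x ≤ ∑ _i : ι, (Fintype.card ι : ℝ) * B := Finset.sum_le_sum fun i _ => h1 i
    _ = _ := by simp; ring

theorem semiconvexNearZero_energy {p : ℝ} (hp : 0 < p) {x : ι → FlatTorus}
    (hx : Function.Injective x) :
    SemiconvexNearZero
      (fun h : ι → EuclideanSpace ℝ (Fin 2) => energy p (fun i => x i + proj (h i))) := by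
  unfold energy
  refine SemiconvexNearZero.sum _ fun i _ => SemiconvexNearZero.sum _ fun j hj => ?_
  have hne : x i - x j ≠ 0 := sub_ne_zero.2 fun h => (Finset.mem_filter.1 hj).2 (hx h).symm
  have key := (semiconvexNearZero_interaction hp hne).comp_linear
    (LinearMap.proj (R := ℝ) (φ := fun _ : ι => EuclideanSpace ℝ (Fin 2)) i - LinearMap.proj j)
    (M := 2) two_pos (fun v => by
      calc ‖v i - v j‖ ≤ ‖v i‖ + ‖v j‖ := norm_sub_le _ _
        _ ≤ 2 * ‖v‖ := by linarith [norm_le_pi_norm v i, norm_le_pi_norm v j])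
  convert key using 3 with h
  rw [dist_eq_norm]
  simp only [LinearMap.sub_apply, LinearMap.proj_apply, proj_sub]
  congr 2
  abel

/-- A form of the principle of symmetric criticality for semiconvex functions: let `T g` be finitely
many norm-nonincreasing maps that leave `f` invariant. If `f` has a local minimum at `0` among
the averages `(1 / |G|) ∑ g, T g v`, then `0` is a critical point of `f`, with a quadratic lower
bound. -/
theorem SemiconvexNearZero.le_of_average {V : Type*} [NormedAddCommGroup V] [NormedSpace ℝ V]
    {f : V → ℝ} (hf : SemiconvexNearZero f) {G : Type*} [Fintype G] [Nonempty G]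
    (T : G → V → V) (hnorm : ∀ g v, ‖T g v‖ ≤ ‖v‖) (hinv : ∀ g v, f (T g v) = f v)
    (hmin : ∃ δ > 0, ∀ v, ‖v‖ < δ → f 0 ≤ f ((Fintype.card G : ℝ)⁻¹ • ∑ g, T g v)) :
    ∃ C δ : ℝ, 0 ≤ C ∧ 0 < δ ∧ ∀ v, ‖v‖ < δ → f 0 - C * ‖v‖ ^ 2 ≤ f v := by
  obtain ⟨C, δ, hC, hδ, h⟩ := hf
  obtain ⟨δ', hδ', hmin⟩ := hmin
  refine ⟨4 * C, min δ δ', by positivity, lt_min hδ hδ', fun v hv => ?_⟩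
  have hG : (0 : ℝ) < Fintype.card G := by exact_mod_cast Fintype.card_pos
  set a : V := (Fintype.card G : ℝ)⁻¹ • ∑ g, T g v with ha
  have hsum : ∑ g, T g v = (Fintype.card G : ℝ) • a := by
    rw [ha, smul_smul, mul_inv_cancel₀ hG.ne', one_smul]
  have han : ‖a‖ ≤ ‖v‖ := by
    rw [ha, norm_smul, norm_inv, Real.norm_of_nonneg hG.le, inv_mul_le_iff₀ hG]
    calc ‖∑ g, T g v‖ ≤ ∑ g, ‖T g v‖ := norm_sum_le _ _
      _ ≤ ∑ _g : G, ‖v‖ := Finset.sum_le_sum fun g _ => hnorm g v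
      _ = _ := by simp
  have hvδ : ‖v‖ < δ := hv.trans_le (min_le_left _ _)
  obtain ⟨L, hL⟩ := h a (han.trans_lt hvδ)
  have h1 : ∀ g, f a + L (T g v - a) - C * (4 * ‖v‖ ^ 2) ≤ f v := by
    intro g
    have h2 := hL (T g v) ((hnorm g v).trans_lt hvδ)
    rw [hinv] at h2
    have h3 : ‖T g v - a‖ ^ 2 ≤ 4 * ‖v‖ ^ 2 := by
      have h4 : ‖T g v - a‖ ≤ 2 * ‖v‖ := (norm_sub_le _ _).trans (by linarith [hnorm g v])
      calc ‖T g v - a‖ ^ 2 ≤ (2 * ‖v‖) ^ 2 := by gcongr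
        _ = _ := by ring
    have h5 := mul_le_mul_of_nonneg_left h3 hC
    linarith
  -- the linear terms cancel in the average over `G`
  have h6 := Finset.sum_le_sum fun g (_ : g ∈ Finset.univ) => h1 g
  have h7 : ∑ g, L (T g v - a) = 0 := by
    rw [← map_sum, Finset.sum_sub_distrib, hsum]
    simp [← Nat.cast_smul_eq_nsmul ℝ]
  rw [Finset.sum_sub_distrib, Finset.sum_add_distrib, h7] at h6
  simp only [Finset.sum_const, Finset.card_univ, nsmul_eq_mul, add_zero, ← mul_sub] at h6
  have h8 := le_of_mul_le_mul_left h6 hG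
  have h9 := hmin v (hv.trans_le (min_le_right _ _))
  linarith

end Energy

/-! ### Configurations made of shifted rows -/

section Rows

variable {m k : ℕ} [NeZero k]

/-- Half a step to the right in a horizontal row of `k` equidistant points, or no shift. -/
noncomputable def rowShift (k : ℕ) (b : Bool) : UnitAddCircle :=
  if b then ((1 / (2 * k) : ℝ) : UnitAddCircle) else 0

/-- The configuration of `m` horizontal rows of `k` equidistant points each, where row `r` has height
`y r` and is shifted by half a step if `s r` holds. -/
noncomputable def rowConfig (k : ℕ) [NeZero k] (s : Fin m → Bool) (y : Fin m → ℝ) :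
    Fin m × ZMod k → FlatTorus :=
  fun q => WithLp.toLp 2 ![ZMod.toAddCircle q.2 + rowShift k (s q.1), (y q.1 : UnitAddCircle)]

@[simp] theorem rowConfig_apply_zero (s : Fin m → Bool) (y : Fin m → ℝ) (q : Fin m × ZMod k) :
    rowConfig k s y q 0 = ZMod.toAddCircle q.2 + rowShift k (s q.1) := rfl

@[simp] theorem rowConfig_apply_one (s : Fin m → Bool) (y : Fin m → ℝ) (q : Fin m × ZMod k) :
    rowConfig k s y q 1 = (y q.1 : UnitAddCircle) := rfl

/-- The number of whole steps in twice the shift of a row. -/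
def rowBit (k : ℕ) (b : Bool) : ZMod k := if b then 1 else 0

theorem rowShift_add_self (b : Bool) :
    rowShift k b + rowShift k b = ZMod.toAddCircle (rowBit k b) := by
  cases b
  · simp [rowShift, rowBit]
  · have h1 : (1 : ZMod k) = ((1 : ℤ) : ZMod k) := by simp
    simp only [rowShift, rowBit, if_true]
    rw [h1, ZMod.toAddCircle_intCast, ← AddCircle.coe_add]
    congr 1
    have : (k : ℝ) ≠ 0 := by exact_mod_cast NeZero.ne k
    push_cast
    field_simp
    norm_num

/-- Reflection of the plane in the vertical axis. -/
noncomputable def reflect (v : EuclideanSpace ℝ (Fin 2)) : EuclideanSpace ℝ (Fin 2) :=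
  !₂[-v 0, v 1]

theorem norm_reflect (v : EuclideanSpace ℝ (Fin 2)) : ‖reflect v‖ = ‖v‖ := by
  refine (sq_eq_sq₀ (norm_nonneg _) (norm_nonneg _)).1 ?_
  simp [EuclideanSpace.norm_sq_eq, reflect]

theorem reflect_sum {ι : Type*} (t : Finset ι) (f : ι → EuclideanSpace ℝ (Fin 2)) :
    ∑ i ∈ t, reflect (f i) = reflect (∑ i ∈ t, f i) := by
  ext j
  fin_cases j <;> simp [reflect]

/-- The action on displacements of the symmetries of a row configuration: translations along the rows
and reflections in a vertical axis, each followed by the relabeling of the points it induces. -/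
noncomputable def rowSymmetry (s : Fin m → Bool) (g : ZMod k × Bool)
    (h : Fin m × ZMod k → EuclideanSpace ℝ (Fin 2)) :
    Fin m × ZMod k → EuclideanSpace ℝ (Fin 2) :=
  fun q => if g.2 then reflect (h (q.1, g.1 - rowBit k (s q.1) - q.2)) else h (q.1, g.1 + q.2)

theorem norm_rowSymmetry_le (s : Fin m → Bool) (g : ZMod k × Bool)
    (h : Fin m × ZMod k → EuclideanSpace ℝ (Fin 2)) : ‖rowSymmetry s g h‖ ≤ ‖h‖ := by
  refine (pi_norm_le_iff_of_nonneg (norm_nonneg h)).2 fun q => ?_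
  unfold rowSymmetry
  split_ifs
  · rw [norm_reflect]
    exact norm_le_pi_norm h _
  · exact norm_le_pi_norm h _

theorem energy_eq_of_isometry {ι : Type*} [Fintype ι] [DecidableEq ι] (p : ℝ) {x x' : ι → FlatTorus}
    (π : Equiv.Perm ι) {φ : FlatTorus → FlatTorus} (hφ : Isometry φ)
    (h : ∀ i, x' i = φ (x (π i))) : energy p x' = energy p x := by
  rw [← energy_comp_equiv p x π]
  exact energy_congr_dist p fun i j => by rw [h, h, hφ.dist_eq]; rfl

theorem energy_rowSymmetry (p : ℝ) (s : Fin m → Bool) (y : Fin m → ℝ) (g : ZMod k × Bool)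
    (h : Fin m × ZMod k → EuclideanSpace ℝ (Fin 2)) :
    energy p (fun q => rowConfig k s y q + proj (rowSymmetry s g h q))
      = energy p (fun q => rowConfig k s y q + proj (h q)) := by
  obtain ⟨a, b⟩ := g
  cases b
  · refine energy_eq_of_isometry p (Equiv.prodShear (Equiv.refl _) fun _ => Equiv.addLeft a)
      (φ := fun z => z - WithLp.toLp 2 ![ZMod.toAddCircle a, 0])
      (Isometry.of_dist_eq fun z w => dist_sub_right _ _ _) fun q => ?_
    ext j
    fin_cases j
    · simp [rowSymmetry, rowConfig, proj]
      abel
    · simp [rowSymmetry, rowConfig, proj]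
  · refine energy_eq_of_isometry p
      (Equiv.prodShear (Equiv.refl _) fun r => Equiv.subLeft (a - rowBit k (s r)))
      (φ := fun z => WithLp.toLp 2 ![-z 0 + ZMod.toAddCircle a, z 1])
      (Isometry.of_dist_eq fun z w => ?_) fun q => ?_
    · refine (sq_eq_sq₀ dist_nonneg dist_nonneg).1 ?_
      rw [dist_eq_norm, dist_eq_norm, norm_sq_eq, norm_sq_eq]
      congr 2
      rw [← norm_neg]
      congr 1
      simp
      abel
    · ext j
      fin_cases j
      · simp [rowSymmetry, rowConfig, proj, reflect, ← rowShift_add_self]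
        abel
      · simp [rowSymmetry, rowConfig, proj, reflect]

/-- The average of a displacement over the symmetries moves each row rigidly up or down. -/
theorem average_rowSymmetry (s : Fin m → Bool) (h : Fin m × ZMod k → EuclideanSpace ℝ (Fin 2)) :
    (Fintype.card (ZMod k × Bool) : ℝ)⁻¹ • ∑ g, rowSymmetry s g h
      = fun q => !₂[0, (k : ℝ)⁻¹ * ∑ c, h (q.1, c) 1] := by
  funext q
  have hk : (k : ℝ) ≠ 0 := by exact_mod_cast NeZero.ne k
  have h1 : ∑ a : ZMod k, h (q.1, a + q.2) = ∑ c, h (q.1, c) :=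
    Fintype.sum_equiv (Equiv.addRight q.2) _ _ fun _ => rfl
  have h2 : ∑ a : ZMod k, h (q.1, a - rowBit k (s q.1) - q.2) = ∑ c, h (q.1, c) :=
    Fintype.sum_equiv ((Equiv.subRight (rowBit k (s q.1))).trans (Equiv.subRight q.2)) _ _
      fun _ => rfl
  rw [Pi.smul_apply, Finset.sum_apply, Fintype.sum_prod_type]
  simp only [rowSymmetry, Fintype.sum_bool, if_true, Bool.false_eq_true, if_false]
  rw [Finset.sum_add_distrib, reflect_sum, h1, h2]
  ext j
  fin_cases j
  · simp [reflect]
  · simp [reflect]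
    field_simp
    ring

/-- A row configuration whose energy is minimal under small vertical movements of the rows is
critical with respect to all displacements. -/
theorem rowConfig_quadratic_lower_bound {p : ℝ} (hp : 0 < p) {s : Fin m → Bool} {y : Fin m → ℝ}
    (hinj : Function.Injective (rowConfig k s y))
    (hmin : ∃ δ > 0, ∀ v : Fin m → ℝ, ‖v‖ < δ →
      energy p (rowConfig k s y) ≤ energy p (rowConfig k s (y + v))) :
    ∃ C δ : ℝ, 0 ≤ C ∧ 0 < δ ∧ ∀ h : Fin m × ZMod k → EuclideanSpace ℝ (Fin 2), ‖h‖ < δ →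
      energy p (rowConfig k s y) - C * ‖h‖ ^ 2
        ≤ energy p (fun q => rowConfig k s y q + proj (h q)) := by
  obtain ⟨δ, hδ, hmin⟩ := hmin
  have hk : (0 : ℝ) < k := by exact_mod_cast Nat.pos_of_ne_zero (NeZero.ne k)
  have key := (semiconvexNearZero_energy hp hinj).le_of_average (rowSymmetry s)
    (fun g h => norm_rowSymmetry_le s g h) (fun g h => energy_rowSymmetry p s y g h)
    ⟨δ, hδ, fun h hh => ?_⟩
  · simpa [proj_zero] using key
  · rw [average_rowSymmetry]
    set v : Fin m → ℝ := fun r => (k : ℝ)⁻¹ * ∑ c, h (r, c) 1 with hv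
    have hvn : ‖v‖ ≤ ‖h‖ := by
      refine (pi_norm_le_iff_of_nonneg (norm_nonneg h)).2 fun r => ?_
      rw [hv, norm_mul, norm_inv, Real.norm_of_nonneg hk.le, inv_mul_le_iff₀ hk]
      calc ‖∑ c, h (r, c) 1‖ ≤ ∑ c, ‖h (r, c) 1‖ := norm_sum_le _ _
        _ ≤ ∑ _c : ZMod k, ‖h‖ := Finset.sum_le_sum fun c _ =>
            (PiLp.norm_apply_le (h (r, c)) 1).trans (norm_le_pi_norm h _)
        _ = k * ‖h‖ := by simp [ZMod.card]
    have h1 := hmin v (hvn.trans_lt hh)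
    have h2 : (fun q => rowConfig k s y q + proj !₂[0, v q.1]) = rowConfig k s (y + v) := by
      funext q
      ext j
      fin_cases j <;> simp [rowConfig, proj]
    have h3 : (fun q => rowConfig k s y q
        + proj ((0 : Fin m × ZMod k → EuclideanSpace ℝ (Fin 2)) q)) = rowConfig k s y := by
      funext q
      simp [proj_zero]
    rw [h2, h3]
    exact h1

end Rows

/-! ### Rigidity of the isometries of the torus -/

theorem norm_circle_le_half (a : UnitAddCircle) : ‖a‖ ≤ 1 / 2 := by
  simpa using AddCircle.norm_le_half_period (1 : ℝ) (x := a) one_ne_zero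

theorem norm_sub_half (a : UnitAddCircle) :
    ‖a - ((1 / 2 : ℝ) : UnitAddCircle)‖ = 1 / 2 - ‖a‖ := by
  obtain ⟨t, rfl, ht, ht'⟩ := exists_circle_lift a
  rw [← ht, ← AddCircle.coe_sub]
  rw [abs_le] at ht'
  rcases le_total 0 t with h | h
  · rw [norm_coe_circle_of_abs_le (abs_le.2 ⟨by linarith, by linarith⟩), abs_of_nonneg h,
      abs_of_nonpos (by linarith)]
    ring
  · have : ((t - 1 / 2 : ℝ) : UnitAddCircle) = ((t + 1 / 2 : ℝ) : UnitAddCircle) := by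
      rw [← AddCircle.coe_add_period (1 : ℝ) (t - 1 / 2)]
      congr 1
      ring
    rw [this, norm_coe_circle_of_abs_le (abs_le.2 ⟨by linarith, by linarith⟩), abs_of_nonpos h,
      abs_of_nonneg (by linarith)]
    ring

theorem circle_eq_or_eq_neg {a : UnitAddCircle} {t : ℝ} (ht : 0 ≤ t) (h : ‖a‖ = t) :
    a = (t : UnitAddCircle) ∨ a = ((-t : ℝ) : UnitAddCircle) := by
  obtain ⟨x, rfl, hx, -⟩ := exists_circle_lift a
  rcases abs_eq_abs.1 ((hx.trans h).trans (abs_of_nonneg ht).symm) with h1 | h1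
  · exact Or.inl (by rw [h1])
  · exact Or.inr (by rw [h1])

theorem circle_eq_half {a : UnitAddCircle} (h : ‖a‖ = 1 / 2) :
    a = ((1 / 2 : ℝ) : UnitAddCircle) := by
  have := norm_sub_half a
  rw [h, sub_self, norm_eq_zero, sub_eq_zero] at this
  exact this

theorem circle_eq_of_norm_eq {a b : UnitAddCircle} (h : ‖a‖ = ‖b‖)
    (h' : ‖a - ((1 / 4 : ℝ) : UnitAddCircle)‖ = ‖b - ((1 / 4 : ℝ) : UnitAddCircle)‖) : a = b := by
  -- only for `t = 0` and `t = 1 / 2` are `t` and `-t` equally far from `1 / 4`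
  have key : ∀ t : ℝ, 0 ≤ t → t ≤ 1 / 2 →
      ‖(t : UnitAddCircle) - ((1 / 4 : ℝ) : UnitAddCircle)‖
        = ‖((-t : ℝ) : UnitAddCircle) - ((1 / 4 : ℝ) : UnitAddCircle)‖ →
      (t : UnitAddCircle) = ((-t : ℝ) : UnitAddCircle) := by
    intro t h0 h1 he
    rw [← AddCircle.coe_sub, ← AddCircle.coe_sub,
      norm_coe_circle_of_abs_le (x := t - 1 / 4) (abs_le.2 ⟨by linarith, by linarith⟩)] at he
    rcases le_or_gt t (1 / 4) with h2 | h2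
    · rw [norm_coe_circle_of_abs_le (abs_le.2 ⟨by linarith, by linarith⟩),
        abs_of_nonpos (by linarith), abs_of_nonpos (by linarith)] at he
      have : t = 0 := by linarith
      simp [this]
    · rw [← AddCircle.coe_add_period (1 : ℝ) (-t - 1 / 4),
        norm_coe_circle_of_abs_le (abs_le.2 ⟨by linarith, by linarith⟩),
        abs_of_nonneg (by linarith), abs_of_nonneg (by linarith)] at he
      rw [← AddCircle.coe_add_period (1 : ℝ) (-t)]
      congr 1
      linarith
  obtain ⟨t, rfl, ht, ht'⟩ := exists_circle_lift a
  obtain ⟨u, rfl, hu, hu'⟩ := exists_circle_lift b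
  have habs : |t| = |u| := by rw [ht, hu, h]
  rcases abs_eq_abs.1 habs with h1 | h1
  · rw [h1]
  · subst h1
    rcases le_total 0 u with h2 | h2
    · exact (key u h2 ((le_abs_self u).trans hu') h'.symm).symm
    · have h3 := key (-u) (by linarith) ((neg_le_abs u).trans hu')
      rw [neg_neg] at h3
      exact h3 h'

/-- The point of the torus with the given coordinates. -/
noncomputable def mk (a b : ℝ) : FlatTorus := proj !₂[a, b]

@[simp] theorem mk_apply_zero (a b : ℝ) : mk a b 0 = (a : UnitAddCircle) := rfl

@[simp] theorem mk_apply_one (a b : ℝ) : mk a b 1 = (b : UnitAddCircle) := rfl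

theorem ext_coord {u v : FlatTorus} (h0 : u 0 = v 0) (h1 : u 1 = v 1) : u = v := by
  ext k
  fin_cases k
  · exact h0
  · exact h1

theorem dist_sq_eq (u v : FlatTorus) : dist u v ^ 2 = ‖u 0 - v 0‖ ^ 2 + ‖u 1 - v 1‖ ^ 2 := by
  rw [dist_eq_norm, norm_sq_eq]
  rfl

theorem coe_zero_circle : ((0 : ℝ) : UnitAddCircle) = 0 := rfl

/-- The possible images of the frame `(1/2, 0)`, `(0, 1/2)`, `(1/4, 0)`, `(0, 1/4)` under an isometry
fixing the origin. -/
noncomputable def frameImages : Finset FlatTorus := by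
  classical
  exact {mk (1 / 2) 0, mk 0 (1 / 2), mk (1 / 4) 0, mk (-(1 / 4)) 0, mk 0 (1 / 4), mk 0 (-(1 / 4))}

theorem card_frameImages_le : frameImages.card ≤ 6 := by
  classical
  exact Finset.card_le_six

/-- The frame used to pin down an isometry. -/
noncomputable def frame : Fin 4 → FlatTorus :=
  ![mk (1 / 2) 0, mk 0 (1 / 2), mk (1 / 4) 0, mk 0 (1 / 4)]

theorem norm_quarter : ‖((1 / 4 : ℝ) : UnitAddCircle)‖ = 1 / 4 := by
  rw [norm_coe_circle_of_abs_le] <;> norm_num [abs_of_pos]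

theorem norm_half : ‖((1 / 2 : ℝ) : UnitAddCircle)‖ = 1 / 2 := by
  rw [norm_coe_circle_of_abs_le] <;> norm_num [abs_of_pos]

/-- A point at distance `1/2` from both the origin and its antipode `(1/2, 1/2)` is `(1/2, 0)` or
`(0, 1/2)`. -/
theorem eq_half_of_dist {z : FlatTorus} (h0 : dist z 0 ^ 2 = 1 / 4)
    (h1 : dist z (mk (1 / 2) (1 / 2)) ^ 2 = 1 / 4) : z = mk (1 / 2) 0 ∨ z = mk 0 (1 / 2) := by
  rw [dist_sq_eq] at h0 h1
  simp only [mk_apply_zero, mk_apply_one, norm_sub_half, PiLp.zero_apply, sub_zero] at h0 h1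
  have hprod : ‖z 0‖ * ‖z 1‖ = 0 := by nlinarith
  rcases mul_eq_zero.1 hprod with h | h
  · right
    have h2 : ‖z 1‖ = 1 / 2 := by
      rw [h] at h0
      nlinarith [norm_nonneg (z 1)]
    exact ext_coord (by simpa using h) (by simpa using circle_eq_half h2)
  · left
    have h2 : ‖z 0‖ = 1 / 2 := by
      rw [h] at h0
      nlinarith [norm_nonneg (z 0)]
    exact ext_coord (by simpa using circle_eq_half h2) (by simpa using h)

theorem mem_frameImages_of_dist {z w : FlatTorus} (hw : w = mk (1 / 2) 0 ∨ w = mk 0 (1 / 2))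
    (h0 : dist z 0 ^ 2 = 1 / 16) (h1 : dist z w ^ 2 = 1 / 16) : z ∈ frameImages := by
  rw [dist_sq_eq] at h0 h1
  simp only [PiLp.zero_apply, sub_zero] at h0
  rcases hw with rfl | rfl
  · simp only [mk_apply_zero, mk_apply_one, norm_sub_half, coe_zero_circle, sub_zero] at h1
    have h2 : ‖z 0‖ = 1 / 4 := by nlinarith
    have h3 : ‖z 1‖ = 0 := by
      rw [h2] at h0
      have : ‖z 1‖ ^ 2 = 0 := by linarith
      exact pow_eq_zero_iff (two_ne_zero) |>.1 this
    rcases circle_eq_or_eq_neg (by norm_num) h2 with h | h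
    · have : z = mk (1 / 4) 0 := ext_coord (by simpa using h) (by simpa using h3)
      simp [frameImages, this]
    · have : z = mk (-(1 / 4)) 0 := ext_coord (by simpa using h) (by simpa using h3)
      simp [frameImages, this]
  · simp only [mk_apply_zero, mk_apply_one, norm_sub_half, coe_zero_circle, sub_zero] at h1
    have h2 : ‖z 1‖ = 1 / 4 := by nlinarith
    have h3 : ‖z 0‖ = 0 := by
      rw [h2] at h0
      have : ‖z 0‖ ^ 2 = 0 := by linarith
      exact pow_eq_zero_iff (two_ne_zero) |>.1 this
    rcases circle_eq_or_eq_neg (by norm_num) h2 with h | h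
    · have : z = mk 0 (1 / 4) := ext_coord (by simpa using h3) (by simpa using h)
      simp [frameImages, this]
    · have : z = mk 0 (-(1 / 4)) := ext_coord (by simpa using h3) (by simpa using h)
      simp [frameImages, this]

theorem isometry_frame_mem {φ : FlatTorus → FlatTorus} (hφ : Isometry φ) (h0 : φ 0 = 0) (i : Fin 4) :
    φ (frame i) ∈ frameImages := by
  -- `(1/2, 1/2)` is the only point at distance `√(1/2)` from the origin
  have hant : φ (mk (1 / 2) (1 / 2)) = mk (1 / 2) (1 / 2) := by
    have h1 : dist (φ (mk (1 / 2) (1 / 2))) 0 ^ 2 = 1 / 2 := by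
      rw [← h0, hφ.dist_eq, dist_sq_eq]
      simp only [mk_apply_zero, mk_apply_one, PiLp.zero_apply, sub_zero, norm_half]
      norm_num
    rw [dist_sq_eq] at h1
    simp only [PiLp.zero_apply, sub_zero] at h1
    have ha := norm_circle_le_half (φ (mk (1 / 2) (1 / 2)) 0)
    have hb := norm_circle_le_half (φ (mk (1 / 2) (1 / 2)) 1)
    have ha0 := norm_nonneg (φ (mk (1 / 2) (1 / 2)) 0)
    have hb0 := norm_nonneg (φ (mk (1 / 2) (1 / 2)) 1)
    exact ext_coord (circle_eq_half (by nlinarith)) (circle_eq_half (by nlinarith))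
  have hdist0 : ∀ z, dist (φ z) 0 ^ 2 = ‖z 0‖ ^ 2 + ‖z 1‖ ^ 2 := by
    intro z
    rw [← h0, hφ.dist_eq, dist_sq_eq]
    simp
  have hdist1 : ∀ z, dist (φ z) (mk (1 / 2) (1 / 2)) ^ 2
      = (1 / 2 - ‖z 0‖) ^ 2 + (1 / 2 - ‖z 1‖) ^ 2 := by
    intro z
    rw [← hant, hφ.dist_eq, dist_sq_eq]
    simp only [mk_apply_zero, mk_apply_one, norm_sub_half]
  have hA := eq_half_of_dist (z := φ (mk (1 / 2) 0))
    (by rw [hdist0]; simp only [mk_apply_zero, mk_apply_one, norm_half, coe_zero_circle, norm_zero]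
        norm_num)
    (by rw [hdist1]; simp only [mk_apply_zero, mk_apply_one, norm_half, coe_zero_circle, norm_zero]
        norm_num)
  have hB := eq_half_of_dist (z := φ (mk 0 (1 / 2)))
    (by rw [hdist0]; simp only [mk_apply_zero, mk_apply_one, norm_half, coe_zero_circle, norm_zero]
        norm_num)
    (by rw [hdist1]; simp only [mk_apply_zero, mk_apply_one, norm_half, coe_zero_circle, norm_zero]
        norm_num)
  have hsub : ∀ w, w = mk (1 / 2) 0 ∨ w = mk 0 (1 / 2) → w ∈ frameImages := by
    rintro w (rfl | rfl) <;> simp [frameImages]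
  fin_cases i
  · exact hsub _ hA
  · exact hsub _ hB
  · change φ (mk (1 / 4) 0) ∈ frameImages
    refine mem_frameImages_of_dist hA ?_ ?_
    · rw [hdist0]
      simp only [mk_apply_zero, mk_apply_one, norm_quarter, coe_zero_circle, norm_zero]
      norm_num
    · rw [hφ.dist_eq, dist_sq_eq]
      simp only [mk_apply_zero, mk_apply_one, norm_quarter, coe_zero_circle, norm_zero,
        norm_sub_half, sub_zero]
      norm_num
  · change φ (mk 0 (1 / 4)) ∈ frameImages
    refine mem_frameImages_of_dist hB ?_ ?_
    · rw [hdist0]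
      simp only [mk_apply_zero, mk_apply_one, norm_quarter, coe_zero_circle, norm_zero]
      norm_num
    · rw [hφ.dist_eq, dist_sq_eq]
      simp only [mk_apply_zero, mk_apply_one, norm_quarter, coe_zero_circle, norm_zero,
        norm_sub_half, sub_zero]
      norm_num

/-- A point of the torus is determined by its distances to the origin and to the frame. -/
theorem eq_of_dist_frame {z w : FlatTorus} (h0 : dist z 0 = dist w 0)
    (h : ∀ i, dist z (frame i) = dist w (frame i)) : z = w := by
  have e0 := congrArg (· ^ 2) h0
  have e1 := congrArg (· ^ 2) (h 0)
  have e2 := congrArg (· ^ 2) (h 1)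
  have e3 := congrArg (· ^ 2) (h 2)
  have e4 := congrArg (· ^ 2) (h 3)
  simp only [dist_sq_eq, frame, Matrix.cons_val, mk_apply_zero, mk_apply_one, PiLp.zero_apply,
    coe_zero_circle, sub_zero, norm_sub_half] at e0 e1 e2 e3 e4
  have ha : ‖z 0‖ = ‖w 0‖ := by linarith
  have hb : ‖z 1‖ = ‖w 1‖ := by linarith
  rw [hb] at e3
  rw [ha] at e4
  refine ext_coord (circle_eq_of_norm_eq ha ?_) (circle_eq_of_norm_eq hb ?_)
  · exact (sq_eq_sq₀ (norm_nonneg _) (norm_nonneg _)).1 (by linarith)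
  · exact (sq_eq_sq₀ (norm_nonneg _) (norm_nonneg _)).1 (by linarith)

/-- An isometry of the torus is determined by the images of the origin and of the frame. -/
theorem isometryEquiv_ext {φ ψ : FlatTorus ≃ᵢ FlatTorus} (h0 : φ 0 = ψ 0)
    (h : ∀ i, φ (frame i) = ψ (frame i)) : φ = ψ := by
  ext1 z
  have : ψ.symm (φ z) = z := by
    refine eq_of_dist_frame ?_ fun i => ?_
    · rw [← ψ.isometry.dist_eq, ψ.apply_symm_apply, ← h0, φ.isometry.dist_eq]
    · rw [← ψ.isometry.dist_eq, ψ.apply_symm_apply, ← h i, φ.isometry.dist_eq]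
  simpa using congrArg ψ this

theorem isometryEquiv_frame_sub_mem (φ : FlatTorus ≃ᵢ FlatTorus) (i : Fin 4) :
    φ (frame i) - φ 0 ∈ frameImages :=
  isometry_frame_mem (φ := fun z => φ z - φ 0)
    (Isometry.of_dist_eq fun z w => by rw [dist_sub_right, φ.isometry.dist_eq]) (sub_self _) i

/-! ### Row heights minimizing the energy -/

theorem norm_rowShift_le {k : ℕ} (b : Bool) : ‖rowShift k b‖ ≤ 1 / (2 * k) := by
  cases b
  · simp [rowShift]
  · refine (norm_coe_circle_le _).trans_eq (abs_of_nonneg (by positivity))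

theorem norm_rowShift_sub_le {k : ℕ} (b b' : Bool) : ‖rowShift k b - rowShift k b'‖ ≤ 1 / (2 * k) := by
  cases b
  · rw [show rowShift k false = 0 from rfl, zero_sub, norm_neg]
    exact norm_rowShift_le b'
  · cases b'
    · rw [show rowShift k false = 0 from rfl, sub_zero]
      exact norm_rowShift_le true
    · rw [sub_self, norm_zero]
      positivity

theorem energy_rowConfig_add_const {m k : ℕ} [NeZero k] (p : ℝ) (s : Fin m → Bool) (y : Fin m → ℝ) (c : ℝ) :
    energy p (rowConfig k s (fun r => y r + c)) = energy p (rowConfig k s y) := by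
  refine energy_congr_dist p fun q q' => ?_
  refine (sq_eq_sq₀ dist_nonneg dist_nonneg).1 ?_
  simp [dist_sq_eq]

section Heights

variable {m k : ℕ} [NeZero k]

theorem one_div_le_norm_toAddCircle {c : ZMod k} (hc : c ≠ 0) :
    (1 / k : ℝ) ≤ ‖ZMod.toAddCircle c‖ := by
  have hk : (0 : ℝ) < k := by exact_mod_cast Nat.pos_of_ne_zero (NeZero.ne k)
  have h1 : c = ((c.val : ℤ) : ZMod k) := by simp
  have h2 : 1 ≤ c.val := Nat.one_le_iff_ne_zero.2 (by simpa [ZMod.val_eq_zero] using hc)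
  have h3 : c.val + 1 ≤ k := ZMod.val_lt c
  have h2' : (1 : ℝ) ≤ c.val := by exact_mod_cast h2
  have h3' : (c.val : ℝ) + 1 ≤ k := by exact_mod_cast h3
  rw [h1, ZMod.toAddCircle_intCast]
  push_cast
  refine le_norm_coe_circle (by gcongr) ?_
  rw [le_sub_iff_add_le, ← add_div, div_le_one hk]
  exact h3'

/-- The vectors of row heights, starting with height `0`, in which any two of the increasingly ordered
rows are at least `g` apart on the circle. -/
def heightCell (m : ℕ) [NeZero m] (g : ℝ) : Set (Fin m → ℝ) :=
  {y | y 0 = 0 ∧ ∀ r r' : Fin m, r < r' → g ≤ y r' - y r ∧ y r' - y r ≤ 1 - g}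

theorem isCompact_heightCell [NeZero m] {g : ℝ} (hg : 0 ≤ g) : IsCompact (heightCell m g) := by
  refine Metric.isCompact_of_isClosed_isBounded ?_ ?_
  · have h1 : heightCell m g = {y | y 0 = 0} ∩ ⋂ r : Fin m, ⋂ r' : Fin m, ⋂ _ : r < r',
        ({y | g ≤ y r' - y r} ∩ {y | y r' - y r ≤ 1 - g}) := by
      ext y
      simp [heightCell]
    rw [h1]
    refine (isClosed_eq (continuous_apply 0) continuous_const).inter ?_
    refine isClosed_iInter fun r => isClosed_iInter fun r' => isClosed_iInter fun _ => ?_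
    exact (isClosed_le (by fun_prop) (by fun_prop)).inter (isClosed_le (by fun_prop) (by fun_prop))
  · refine (Metric.isBounded_closedBall (x := (0 : Fin m → ℝ)) (r := 1)).subset fun y hy => ?_
    rw [mem_closedBall_zero_iff, pi_norm_le_iff_of_nonneg zero_le_one]
    intro r
    rw [Real.norm_eq_abs, abs_le]
    rcases eq_or_ne r 0 with rfl | hr
    · rw [hy.1]
      norm_num
    · have h2 := hy.2 0 r (Fin.pos_iff_ne_zero.2 hr)
      rw [hy.1] at h2
      constructor <;> linarith [h2.1, h2.2]

theorem uniform_mem_heightCell [NeZero m] {g : ℝ} (hg : g ≤ 1 / m) :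
    (fun r : Fin m => (r : ℝ) / m) ∈ heightCell m g := by
  have hm : (0 : ℝ) < m := by exact_mod_cast Nat.pos_of_ne_zero (NeZero.ne m)
  refine ⟨by simp, fun r r' h => ?_⟩
  have h1 : (r : ℕ) + 1 ≤ r' := h
  have h2 : (r' : ℕ) + 1 ≤ m := r'.2
  have h1' : (r : ℝ) + 1 ≤ (r' : ℕ) := by exact_mod_cast h1
  have h2' : ((r' : ℕ) : ℝ) + 1 ≤ m := by exact_mod_cast h2
  have h3 : (0 : ℝ) ≤ (r : ℕ) := Nat.cast_nonneg _
  rw [← sub_div]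
  constructor
  · refine hg.trans ?_
    gcongr
    linarith
  · have h4 : ((r' : ℕ) - (r : ℕ) : ℝ) / m ≤ 1 - 1 / m := by
      rw [le_sub_iff_add_le, ← add_div, div_le_one hm]
      linarith
    linarith

theorem le_dist_rowConfig [NeZero m] {g a : ℝ} (hag : a ≤ g) (hak : a ≤ 1 / k)
    {y : Fin m → ℝ} (hy : y ∈ heightCell m g) (s : Fin m → Bool) {q q' : Fin m × ZMod k} (hq : q ≠ q') :
    a ≤ dist (rowConfig k s y q) (rowConfig k s y q') := by
  have hsep : ∀ r r' : Fin m, r < r' → a ≤ ‖(y r : UnitAddCircle) - (y r' : UnitAddCircle)‖ := by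
    intro r r' h
    rw [← norm_neg, neg_sub, ← AddCircle.coe_sub]
    have := hy.2 r r' h
    exact le_norm_coe_circle (hag.trans this.1) (by linarith [this.2])
  rw [dist_eq_norm]
  by_cases h : q.1 = q'.1
  · refine le_trans ?_ (PiLp.norm_apply_le (rowConfig k s y q - rowConfig k s y q') 0)
    have hc : q.2 - q'.2 ≠ 0 := fun h' => hq (Prod.ext h (sub_eq_zero.1 h'))
    refine hak.trans ((one_div_le_norm_toAddCircle hc).trans_eq ?_)
    simp [h]
  · refine le_trans ?_ (PiLp.norm_apply_le (rowConfig k s y q - rowConfig k s y q') 1)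
    rw [PiLp.sub_apply, rowConfig_apply_one, rowConfig_apply_one]
    rcases lt_or_gt_of_ne h with h | h
    · exact hsep _ _ h
    · rw [← norm_neg, neg_sub]
      exact hsep _ _ h

theorem rowConfig_injective [NeZero m] {g : ℝ} (hg : 0 < g) {y : Fin m → ℝ} (hy : y ∈ heightCell m g)
    (s : Fin m → Bool) : Function.Injective (rowConfig k s y) := by
  have hk : (0 : ℝ) < k := by exact_mod_cast Nat.pos_of_ne_zero (NeZero.ne k)
  intro q q' h
  by_contra hq
  have h1 := le_dist_rowConfig (min_le_left g (1 / k)) (min_le_right _ _) hy s hq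
  rw [h, dist_self] at h1
  exact absurd h1 (not_le.2 (lt_min hg (by positivity)))

/-- If two rows come within `1 / (4k)` of each other, their interaction alone outweighs the energy of
`n` points at mutual distance at least `1 / k`, as long as `n ^ 2 < exp (p / 2)`. -/
theorem exp_mul_le_energy_of_rows_close {p : ℝ} (hp : 0 < p) (s : Fin m → Bool) {y : Fin m → ℝ}
    (hinj : Function.Injective (rowConfig k s y)) {r r' : Fin m} (hr : r ≠ r')
    (hclose : ‖((y r' - y r : ℝ) : UnitAddCircle)‖ ≤ 1 / (4 * k)) :
    Real.exp (p / 2) * (k : ℝ) ^ p ≤ energy p (rowConfig k s y) := by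
  have hk : (0 : ℝ) < k := by exact_mod_cast Nat.pos_of_ne_zero (NeZero.ne k)
  have hne : ((r', 0) : Fin m × ZMod k) ≠ (r, 0) := fun h => hr (congrArg Prod.fst h).symm
  refine le_trans ?_ (one_div_dist_rpow_le_energy p _ hne.symm)
  set d := dist (rowConfig k s y (r', 0)) (rowConfig k s y (r, 0)) with hd
  have hd0 : 0 < d := dist_pos.2 (hinj.ne hne)
  have hd2 : d ^ 2 ≤ 5 / (16 * (k : ℝ) ^ 2) := by
    have h1 := norm_rowShift_sub_le (k := k) (s r') (s r)
    calc d ^ 2 = ‖rowShift k (s r') - rowShift k (s r)‖ ^ 2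
          + ‖((y r' - y r : ℝ) : UnitAddCircle)‖ ^ 2 := by
            rw [hd, dist_sq_eq]
            simp
      _ ≤ (1 / (2 * (k : ℝ))) ^ 2 + (1 / (4 * (k : ℝ))) ^ 2 := by gcongr
      _ = _ := by
          field_simp
          norm_num
  have h2 : Real.exp 1 * (k : ℝ) ^ 2 ≤ (d ^ 2)⁻¹ := by
    rw [le_inv_comm₀ (by positivity) (by positivity)]
    refine hd2.trans ?_
    rw [mul_inv, div_eq_mul_inv, mul_inv, ← mul_assoc]
    gcongr
    rw [le_inv_comm₀ (by norm_num) (by positivity)]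
    have := Real.exp_one_lt_d9
    norm_num at this ⊢
    linarith
  have h3 : (1 : ℝ) / d ^ p = ((d ^ 2)⁻¹) ^ (p / 2) := by
    rw [Real.inv_rpow (by positivity), ← Real.rpow_natCast, ← Real.rpow_mul hd0.le, one_div]
    congr 2
    push_cast
    ring
  rw [h3]
  calc Real.exp (p / 2) * (k : ℝ) ^ p = (Real.exp 1 * (k : ℝ) ^ 2) ^ (p / 2) := by
        rw [Real.mul_rpow (by positivity) (by positivity), ← Real.exp_mul, one_mul,
          ← Real.rpow_natCast, ← Real.rpow_mul hk.le]
        congr 2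
        push_cast
        ring
    _ ≤ _ := by gcongr

theorem continuousOn_energy_rowConfig [NeZero m] {g : ℝ} (hg : 0 < g) (p : ℝ) (s : Fin m → Bool) :
    ContinuousOn (fun y => energy p (rowConfig k s y)) (heightCell m g) := by
  unfold energy
  refine continuousOn_finsetSum _ fun q _ => continuousOn_finsetSum _ fun q' hq' => ?_
  have hcont : ∀ q : Fin m × ZMod k, Continuous fun y : Fin m → ℝ => rowConfig k s y q := by
    intro q
    refine (PiLp.continuous_toLp 2 _).comp (continuous_pi fun j => ?_)
    fin_cases j
    · exact continuous_const
    · exact (AddCircle.continuous_mk' 1).comp (continuous_apply q.1)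
  have hpos : ∀ y ∈ heightCell m g, 0 < dist (rowConfig k s y q) (rowConfig k s y q') :=
    fun y hy => dist_pos.2 ((rowConfig_injective hg hy s).ne (Finset.mem_filter.1 hq').2.symm)
  refine continuousOn_const.div ?_ fun y hy => (Real.rpow_pos_of_pos (hpos y hy) p).ne'
  exact ((hcont q).dist (hcont q')).continuousOn.rpow_const fun y hy => Or.inl (hpos y hy).ne'

/-- For every choice of row shifts there are row heights, in increasing order, that make the row
configuration critical: the energy restricted to the cell of ordered heights attains its minimum away
from the boundary of the cell, because equidistant heights have less energy than any heights on the
boundary. -/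
theorem exists_heights [NeZero m] {p : ℝ} (hp : 0 < p) (hmk : m ≤ k)
    (hn : ((m * k : ℕ) : ℝ) ^ 2 < Real.exp (p / 2)) (s : Fin m → Bool) :
    ∃ y : Fin m → ℝ, y 0 = 0 ∧ StrictMono y ∧ (∀ r, y r ∈ Set.Ico (0 : ℝ) 1) ∧
      Function.Injective (rowConfig k s y) ∧
      ∃ C δ : ℝ, 0 ≤ C ∧ 0 < δ ∧ ∀ h : Fin m × ZMod k → EuclideanSpace ℝ (Fin 2), ‖h‖ < δ →
        energy p (rowConfig k s y) - C * ‖h‖ ^ 2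
          ≤ energy p (fun q => rowConfig k s y q + proj (h q)) := by
  have hk : (0 : ℝ) < k := by exact_mod_cast Nat.pos_of_ne_zero (NeZero.ne k)
  have hm : (0 : ℝ) < m := by exact_mod_cast Nat.pos_of_ne_zero (NeZero.ne m)
  have hkm : (1 : ℝ) / k ≤ 1 / m := by
    gcongr
  set g : ℝ := 1 / (4 * k) with hg
  have hg0 : 0 < g := by positivity
  have hgk : g ≤ 1 / k := by
    rw [hg]
    gcongr
    linarith
  obtain ⟨y, hy, hymin⟩ := (isCompact_heightCell hg0.le).exists_isMinOn
    ⟨_, uniform_mem_heightCell (hgk.trans hkm)⟩ (continuousOn_energy_rowConfig (k := k) hg0 p s)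
  have hlt : energy p (rowConfig k s y) < Real.exp (p / 2) * (k : ℝ) ^ p := by
    refine (hymin (uniform_mem_heightCell (hgk.trans hkm))).trans_lt ?_
    refine (energy_le_of_forall_le (B := (k : ℝ) ^ p) (by positivity) fun q q' hq => ?_).trans_lt ?_
    · have h1 := le_dist_rowConfig hkm le_rfl (uniform_mem_heightCell le_rfl) s hq.symm
      calc _ ≤ 1 / (1 / (k : ℝ)) ^ p := by gcongr
        _ = (k : ℝ) ^ p := by rw [one_div, one_div, Real.inv_rpow hk.le, inv_inv]
    · rw [Fintype.card_prod, Fintype.card_fin, ZMod.card]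
      gcongr
  have hinj := rowConfig_injective (k := k) hg0 hy s
  have hstrict : ∀ r r' : Fin m, r < r' → g < y r' - y r ∧ y r' - y r < 1 - g := by
    intro r r' h
    obtain ⟨h1, h2⟩ := hy.2 r r' h
    have hfar : ¬ ‖((y r' - y r : ℝ) : UnitAddCircle)‖ ≤ g := fun hc =>
      absurd (exp_mul_le_energy_of_rows_close hp s hinj h.ne hc) (not_le.2 hlt)
    refine ⟨lt_of_le_of_ne h1 fun he => hfar ?_, lt_of_le_of_ne h2 fun he => hfar ?_⟩
    · rw [← he]
      exact (norm_coe_circle_le g).trans_eq (abs_of_pos hg0)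
    · rw [he, sub_eq_neg_add, AddCircle.coe_add_period, AddCircle.coe_neg, norm_neg]
      exact (norm_coe_circle_le g).trans_eq (abs_of_pos hg0)
  refine ⟨y, hy.1, fun r r' h => by linarith [(hstrict r r' h).1], fun r => ?_, hinj,
    rowConfig_quadratic_lower_bound hp hinj ?_⟩
  · rcases eq_or_ne r 0 with rfl | hr
    · simp [hy.1]
    · have h2 := hstrict 0 r (Fin.pos_iff_ne_zero.2 hr)
      rw [hy.1] at h2
      constructor <;> linarith [h2.1, h2.2]
  · have hev : ∀ᶠ v in 𝓝 (0 : Fin m → ℝ), ∀ r r' : Fin m, r < r' →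
        g < (y r' + v r') - (y r + v r) ∧ (y r' + v r') - (y r + v r) < 1 - g := by
      refine Filter.eventually_all.2 fun r => Filter.eventually_all.2 fun r' => ?_
      by_cases h : r < r'
      · have hc : Filter.Tendsto (fun v : Fin m → ℝ => (y r' + v r') - (y r + v r)) (𝓝 0)
            (𝓝 (y r' - y r)) := by
          have : Continuous (fun v : Fin m → ℝ => (y r' + v r') - (y r + v r)) := by fun_prop
          simpa using this.tendsto 0
        filter_upwards [hc.eventually_const_lt (hstrict r r' h).1,
          hc.eventually_lt_const (hstrict r r' h).2] with v h1 h2 _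
        exact ⟨h1, h2⟩
      · exact Filter.Eventually.of_forall fun v h' => absurd h' h
    obtain ⟨δ, hδ, hball⟩ := Metric.eventually_nhds_iff.1 hev
    refine ⟨δ, hδ, fun v hv => ?_⟩
    have hv' := hball (by simpa using hv)
    -- the cell is normalized by `y 0 = 0`, so the moved rows are translated back first
    rw [← energy_rowConfig_add_const p s (y + v) (-v 0)]
    refine hymin ⟨by simp [hy.1], fun r r' h => ?_⟩
    have h1 := hv' r r' h
    simp only [Pi.add_apply]
    constructor <;> linarith [h1.1, h1.2]

/-! ### Counting the configurations up to symmetry -/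

theorem rowShift_inj_of_add {b b' : Bool} {c c' : ZMod k}
    (h : ZMod.toAddCircle c + rowShift k b = ZMod.toAddCircle c' + rowShift k b') : b = b' := by
  have hk : (1 : ℝ) ≤ k := by exact_mod_cast Nat.one_le_iff_ne_zero.2 (NeZero.ne k)
  -- a nonzero multiple of `1 / k` has norm at least `1 / k`
  have key : ∀ c : ZMod k, rowShift k true ≠ ZMod.toAddCircle c := by
    intro c hc
    have h1 : ‖rowShift k true‖ = 1 / (2 * k) := by
      have h0 : (1 : ℝ) / (2 * k) ≤ 1 / 2 := by
        gcongr
        linarith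
      rw [rowShift, if_pos rfl, norm_coe_circle_of_abs_le] <;> rw [abs_of_pos (by positivity)]
      exact h0
    rcases eq_or_ne c 0 with rfl | h0
    · rw [hc, map_zero, norm_zero] at h1
      have : (0 : ℝ) < 1 / (2 * k) := by positivity
      linarith
    · have h2 := one_div_le_norm_toAddCircle h0
      rw [← hc, h1] at h2
      have : (1 : ℝ) / (2 * k) < 1 / k := by
        gcongr
        linarith
      linarith
  have hf : rowShift k false = 0 := rfl
  cases b <;> cases b'
  · rfl
  · rw [hf, add_zero] at h
    exact absurd (by rw [map_sub, h]; abel) (key (c - c'))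
  · rw [hf, add_zero] at h
    exact absurd (by rw [map_sub, ← h]; abel) (key (c' - c))
  · rfl

/-- The set of points of a row configuration with increasing heights determines the row shifts. -/
theorem eq_of_range_rowConfig_eq {s s' : Fin m → Bool} {y y' : Fin m → ℝ} (hy : StrictMono y)
    (hy' : StrictMono y') (hy01 : ∀ r, y r ∈ Set.Ico (0 : ℝ) 1)
    (hy01' : ∀ r, y' r ∈ Set.Ico (0 : ℝ) 1)
    (h : Set.range (rowConfig k s y) = Set.range (rowConfig k s' y')) : s = s' := by
  have hsub : ∀ {s s' : Fin m → Bool} {y y' : Fin m → ℝ}, (∀ r, y r ∈ Set.Ico (0 : ℝ) 1) →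
      (∀ r, y' r ∈ Set.Ico (0 : ℝ) 1) →
      Set.range (rowConfig k s y) = Set.range (rowConfig k s' y') →
      ∀ r, ∃ q : Fin m × ZMod k, y' q.1 = y r ∧
        ZMod.toAddCircle q.2 + rowShift k (s' q.1) = ZMod.toAddCircle (0 : ZMod k) + rowShift k (s r) := by
    intro s s' y y' hy hy' h r
    obtain ⟨q, hq⟩ : rowConfig k s y (r, 0) ∈ Set.range (rowConfig k s' y') :=
      h ▸ Set.mem_range_self _
    refine ⟨q, ?_, congrArg (fun z : FlatTorus => z 0) hq⟩
    have h1 : (y' q.1 : UnitAddCircle) = (y r : UnitAddCircle) :=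
      congrArg (fun z : FlatTorus => z 1) hq
    rwa [AddCircle.coe_eq_coe_iff_of_mem_Ico (a := 0) (by simpa using hy' q.1)
      (by simpa using hy r)] at h1
  have hyy : y = y' := by
    refine (StrictMono.range_inj hy hy').1 (Set.Subset.antisymm ?_ ?_)
    · rintro _ ⟨r, rfl⟩
      obtain ⟨q, hq, -⟩ := hsub hy01 hy01' h r
      exact ⟨q.1, hq⟩
    · rintro _ ⟨r, rfl⟩
      obtain ⟨q, hq, -⟩ := hsub hy01' hy01 h.symm r
      exact ⟨q.1, hq⟩
  subst hyy
  funext r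
  obtain ⟨q, hq, hq'⟩ := hsub hy01 hy01' h r
  rw [hy.injective hq] at hq'
  exact (rowShift_inj_of_add hq').symm

end Heights

theorem isCriticalPoint_comp_equiv {ι : Type*} [Fintype ι] [DecidableEq ι] {n : ℕ} {p : ℝ}
    {x : ι → FlatTorus} (hx : Function.Injective x) (e : Fin n ≃ ι)
    (h : ∃ C δ : ℝ, 0 ≤ C ∧ 0 < δ ∧ ∀ h : ι → EuclideanSpace ℝ (Fin 2), ‖h‖ < δ →
      energy p x - C * ‖h‖ ^ 2 ≤ energy p (fun q => x q + proj (h q))) :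
    IsCriticalPoint p (x ∘ e) := by
  obtain ⟨C, δ, hC, hδ, h⟩ := h
  refine ⟨hx.comp e.injective, fun ε hε => ?_⟩
  have hr : 0 < min δ (ε / (C + 1)) := lt_min hδ (by positivity)
  filter_upwards [Metric.ball_mem_nhds 0 hr] with v hv
  rw [mem_ball_zero_iff] at hv
  have hnorm : ‖v ∘ e.symm‖ ≤ ‖v‖ :=
    (pi_norm_le_iff_of_nonneg (norm_nonneg v)).2 fun i => norm_le_pi_norm v _
  have h1 := h (v ∘ e.symm) (hnorm.trans_lt (hv.trans_le (min_le_left _ _)))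
  have h2 : energy p (fun q => x q + proj ((v ∘ e.symm) q))
      = rieszEnergy p (fun i => (x ∘ e) i + proj (v i)) := by
    rw [← energy_comp_equiv p _ e]
    simp [energy, rieszEnergy]
  have h3 : energy p x = rieszEnergy p (x ∘ e) := (energy_comp_equiv p x e).symm
  rw [h2, h3] at h1
  have h4 : C * ‖v ∘ e.symm‖ ^ 2 ≤ ε * ‖v‖ := by
    have h5 : ‖v‖ * (C + 1) ≤ ε :=
      (le_div_iff₀ (by positivity)).1 (hv.le.trans (min_le_right _ _))
    have h6 : ‖v ∘ e.symm‖ ^ 2 ≤ ‖v‖ ^ 2 := by gcongr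
    calc C * ‖v ∘ e.symm‖ ^ 2 ≤ C * ‖v‖ ^ 2 := by gcongr
      _ ≤ (‖v‖ * (C + 1)) * ‖v‖ := by nlinarith [sq_nonneg ‖v‖]
      _ ≤ ε * ‖v‖ := by gcongr
  linarith

/-- A family of critical configurations that contain the origin and have pairwise different sets of
points represents few configurations per class: an isometry taking a member of the family to a fixed
member is determined by the image of the origin, one of `n` points, and the images of the frame. -/
theorem card_le_mul_card_image_quotient {T : Type*} [Fintype T] {n : ℕ} (X : T → Fin n → FlatTorus)
    (h0 : ∀ t, 0 ∈ Set.range (X t)) (hX : ∀ t t', Set.range (X t) = Set.range (X t') → t = t')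
    [DecidableEq (Quotient (symmetrySetoid n))] :
    Fintype.card T
      ≤ n * 6 ^ 4 * (Finset.univ.image fun t => Quotient.mk (symmetrySetoid n) (X t)).card := by
  classical
  refine Finset.card_le_mul_card_image _ _ fun b hb => ?_
  obtain ⟨t₀, -, rfl⟩ := Finset.mem_image.1 hb
  have hex : ∀ t, ∃ φ : FlatTorus ≃ᵢ FlatTorus,
      Quotient.mk (symmetrySetoid n) (X t) = Quotient.mk (symmetrySetoid n) (X t₀) →
        φ '' Set.range (X t) = Set.range (X t₀) := by
    intro t
    by_cases h : Quotient.mk (symmetrySetoid n) (X t) = Quotient.mk (symmetrySetoid n) (X t₀)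
    · obtain ⟨σ, φ, hφ⟩ := Quotient.exact h
      refine ⟨φ, fun _ => ?_⟩
      have h1 : X t₀ = φ ∘ X t ∘ σ := funext hφ
      rw [h1, Set.range_comp, σ.surjective.range_comp]
    · exact ⟨IsometryEquiv.refl _, fun h' => absurd h' h⟩
  choose φ hφ using hex
  have hcard : ((Finset.univ.image (X t₀)) ×ˢ
      Fintype.piFinset fun _ : Fin 4 => frameImages).card ≤ n * 6 ^ 4 := by
    rw [Finset.card_product, Fintype.card_piFinset_const]
    refine Nat.mul_le_mul (Finset.card_image_le.trans_eq (by simp)) ?_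
    exact Nat.pow_le_pow_left card_frameImages_le 4
  refine (Finset.card_le_card_of_injOn
    (fun t => (φ t 0, fun i => φ t (frame i) - φ t 0)) (fun t ht => ?_) ?_).trans hcard
  · have h1 := hφ t (Finset.mem_filter.1 ht).2
    refine Finset.mem_product.2 ⟨?_, Fintype.mem_piFinset.2 fun i => isometryEquiv_frame_sub_mem _ i⟩
    obtain ⟨i, hi⟩ : φ t 0 ∈ Set.range (X t₀) := h1 ▸ Set.mem_image_of_mem _ (h0 t)
    exact Finset.mem_image.2 ⟨i, Finset.mem_univ _, hi⟩
  · intro t ht t' ht' he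
    have h1 := hφ t (Finset.mem_filter.1 ht).2
    have h2 := hφ t' (Finset.mem_filter.1 ht').2
    obtain ⟨he0, he1⟩ := Prod.ext_iff.1 he
    have hφφ : φ t = φ t' := isometryEquiv_ext he0 fun i => by
      have h3 := congrFun he1 i
      simp only at he0 h3
      rwa [he0, sub_left_inj] at h3
    rw [hφφ, ← h2] at h1
    exact hX t t' ((φ t').injective.image_injective h1)

theorem exists_finset_criticalClasses {n m k : ℕ} [NeZero k] (hnk : n = (m + 1) * k)
    (hmk : m + 1 ≤ k) {p : ℝ} (hp : 0 < p) (hn : (n : ℝ) ^ 2 < Real.exp (p / 2)) :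
    ∃ S : Finset (Quotient (symmetrySetoid n)), ↑S ⊆ criticalClasses n p ∧
      2 ^ m ≤ n * 6 ^ 4 * S.card := by
  classical
  have e : Fin n ≃ Fin (m + 1) × ZMod k := Fintype.equivOfCardEq (by simp [hnk, ZMod.card])
  subst hnk
  choose y hy0 hymono hy01 hyinj hycrit using exists_heights (m := m + 1) hp hmk hn
  -- row `0` is never shifted, so that all configurations contain the origin
  set X : (Fin m → Bool) → Fin ((m + 1) * k) → FlatTorus := fun t =>
    rowConfig k (Fin.cons false t) (y (Fin.cons false t)) ∘ e with hX
  refine ⟨Finset.univ.image fun t => Quotient.mk (symmetrySetoid _) (X t), ?_, ?_⟩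
  · intro b hb
    obtain ⟨t, -, rfl⟩ := Finset.mem_image.1 hb
    exact ⟨X t, isCriticalPoint_comp_equiv (hyinj _) e (hycrit _), rfl⟩
  · have h1 := card_le_mul_card_image_quotient X (fun t => ⟨e.symm (0, 0), ?_⟩) fun t t' h => ?_
    · simpa using h1
    · simp only [hX, Function.comp_apply, Equiv.apply_symm_apply]
      refine ext_coord ?_ ?_
      · simp [rowShift]
      · simp [hy0]
    · simp only [hX, e.surjective.range_comp] at h
      have h2 := eq_of_range_rowConfig_eq (hymono _) (hymono _) (hy01 _) (hy01 _) h
      exact (Fin.cons_injective2 h2).2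

end FlatTorus

theorem theorem1 :
    ∃ c₁ c₂ : ℝ, 0 < c₁ ∧ 0 < c₂ ∧ ∃ A : Set ℕ,
      A = {n : ℕ | ∃ ℓ : ℕ, 1 ≤ ℓ ∧ n = 60 * ℓ ^ 2} ∧ A.Infinite ∧
      ∀ n ∈ A, ∀ p : ℝ, 5 * Real.log n < p →
        ENNReal.ofReal (c₁ * Real.exp (c₂ * Real.sqrt n)) ≤
          ((FlatTorus.criticalClasses n p).encard : ℝ≥0∞) := by
  refine ⟨1 / (2 * 60 * 6 ^ 4), 1 / 8, by norm_num, by norm_num, _, rfl, ?_, ?_⟩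
  · refine Set.infinite_of_injective_forall_mem (f := fun ℓ : ℕ => 60 * (ℓ + 1) ^ 2) ?_
      fun ℓ => ⟨ℓ + 1, by omega, rfl⟩
    intro a b h
    have h1 : (a + 1) ^ 2 = (b + 1) ^ 2 := Nat.eq_of_mul_eq_mul_left (by norm_num) h
    have h2 := Nat.pow_left_injective two_ne_zero h1
    omega
  rintro n ⟨ℓ, hℓ, rfl⟩ p hp
  have hn1 : (1 : ℝ) < ((60 * ℓ ^ 2 : ℕ) : ℝ) := by
    have : 1 < 60 * ℓ ^ 2 := by nlinarith
    exact_mod_cast this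
  have hlog := Real.log_pos hn1
  have hsq : ((60 * ℓ ^ 2 : ℕ) : ℝ) ^ 2 < Real.exp (p / 2) := by
    rw [← Real.log_lt_iff_lt_exp (by positivity), Real.log_pow]
    push_cast at hp hlog ⊢
    linarith
  have : NeZero (10 * ℓ) := ⟨by omega⟩
  -- `6ℓ` rows of `10ℓ` points: equidistant rows are then farther apart than the points in a row
  obtain ⟨S, hS, hcard⟩ := FlatTorus.exists_finset_criticalClasses (n := 60 * ℓ ^ 2)
    (m := 6 * ℓ - 1) (k := 10 * ℓ) (by rw [Nat.sub_add_cancel (by omega)]; ring) (by omega)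
    (by linarith) hsq
  have hS' : ((S.card : ℕ∞) : ℝ≥0∞) ≤ ((FlatTorus.criticalClasses (60 * ℓ ^ 2) p).encard : ℝ≥0∞) := by
    rw [ENat.toENNReal_le, ← Set.encard_coe_eq_coe_finsetCard]
    exact Set.encard_le_encard hS
  refine le_trans ?_ hS'
  rw [ENat.toENNReal_coe, ← ENNReal.ofReal_natCast]
  refine ENNReal.ofReal_le_ofReal ?_
  have hexp : Real.exp (1 / 8 * Real.sqrt ((60 * ℓ ^ 2 : ℕ) : ℝ)) ≤ 3 ^ ℓ := by
    have h1 : Real.sqrt ((60 * ℓ ^ 2 : ℕ) : ℝ) ≤ 8 * ℓ := by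
      rw [Real.sqrt_le_left (by positivity)]
      push_cast
      nlinarith [sq_nonneg (ℓ : ℝ)]
    calc _ ≤ Real.exp (ℓ * 1) := Real.exp_le_exp.2 (by linarith)
      _ = Real.exp 1 ^ ℓ := Real.exp_nat_mul 1 ℓ
      _ ≤ 3 ^ ℓ := by
          gcongr
          linarith [Real.exp_one_lt_d9]
  have hpow : (3 : ℝ) ^ ℓ * ℓ ^ 2 ≤ 64 ^ ℓ := by
    have h1 : (ℓ : ℝ) ^ 2 ≤ 4 ^ ℓ := by
      have : (ℓ : ℝ) ≤ 2 ^ ℓ := by exact_mod_cast Nat.lt_two_pow_self.le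
      calc (ℓ : ℝ) ^ 2 ≤ (2 ^ ℓ) ^ 2 := by gcongr
        _ = 4 ^ ℓ := by rw [← pow_mul, mul_comm, pow_mul]; norm_num
    calc (3 : ℝ) ^ ℓ * ℓ ^ 2 ≤ 3 ^ ℓ * 4 ^ ℓ := by gcongr
      _ = 12 ^ ℓ := by rw [← mul_pow]; norm_num
      _ ≤ 64 ^ ℓ := by gcongr; norm_num
  have h64 : (64 : ℝ) ^ ℓ = 2 * 2 ^ (6 * ℓ - 1) := by
    rw [← pow_succ', Nat.sub_add_cancel (by omega), pow_mul]
    norm_num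
  have hcard' : (2 : ℝ) ^ (6 * ℓ - 1) ≤ 60 * ℓ ^ 2 * 6 ^ 4 * S.card := by exact_mod_cast hcard
  have hℓ2 : (0 : ℝ) < (ℓ : ℝ) ^ 2 := by
    have : (0 : ℝ) < ℓ := by exact_mod_cast hℓ
    positivity
  have h5 : (3 : ℝ) ^ ℓ ≤ 2 * 60 * 6 ^ 4 * S.card := by
    refine le_of_mul_le_mul_right ?_ hℓ2
    calc (3 : ℝ) ^ ℓ * ℓ ^ 2 ≤ 2 * 2 ^ (6 * ℓ - 1) := hpow.trans_eq h64
      _ ≤ 2 * (60 * ℓ ^ 2 * 6 ^ 4 * S.card) := by gcongr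
      _ = _ := by ring
  rw [one_div_mul_eq_div, div_le_iff₀ (by norm_num)]
  linarith
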